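/- **Theorem 3.8.** Let $p,q,r,s$ be real numbers with $p,q\ge 0$, $0\le r<1$, $p+q+r=1$ and $0\le s\le 1$. Let $(X_n)_{n\ge1}$ be the steps of the elephant random walk with stops: $X_1=1$ with probability $s$ and $X_1=-1$ with probability $1-s$; and for every $n\ge1$, conditionally on $X_1,\dots,X_n$, an index $k$ is chosen uniformly in $\{1,\dots,n\}$ and $X_{n+1}$ equals $X_k$, $-X_k$ or $0$ with probability $p$, $q$ and $r$, respectively. Let $S_n=X_1+\cdots+X_n$. Assume the superdiffusive regime $\frac{p}{1-r}>\frac34$. Then $S_n/n^{2p+r-1}$ converges almost surely to a real random variable $L$, this $L$ has a finite fourth moment, and $$\mathbb{E}[L]=\frac{2s-1}{(2p+r-1)\,\Gamma(2p+r-1)},\qquad \mathbb{E}[L^2]=\frac{1}{(4p+3(r-1))\,\Gamma(2(2p+r-1))},$$ $$\mathbb{E}[L^3]=\frac{2p(2s-1)}{(2p+r-1)(4p+3(r-1))\,\Gamma(3(2p+r-1))},$$ $$\mathbb{E}[L^4]=\frac{6\bigl(8p^2-4p(1-r)-(1-r)^2\bigr)}{(8p+5(r-1))(4p+3(r-1))^2\,\Gamma(4(2p+r-1))}.$$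 -/

import Mathlib

open MeasureTheory Filter Topology

noncomputable section

/-- The probability that the next step equals `y` when the recalled step is `x`: the new step is
`x` with probability `p`, `-x` with probability `q` and `0` with probability `r` (that is, the mass
at `y` of `p δ_x + q δ_{-x} + r δ_0`; the three cases may coincide, e.g. when `x = 0`). -/
def recallProb (p q r x y : ℝ) : ℝ :=
  (if y = x then p else 0) + (if y = -x then q else 0) + (if y = 0 then r else 0)

/-- The sigma-algebra `σ(X₁, …, Xₙ)` generated by the first `n` steps. -/
abbrev stepHistory {Ω : Type*} (X : ℕ → Ω → ℝ) (n : ℕ) : MeasurableSpace Ω :=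
  ⨆ k ∈ Finset.Icc 1 n, MeasurableSpace.comap (X k) inferInstance

/-- `X₁, X₂, …` are the steps of an elephant random walk with stops with parameters `p, q, r`
and first-step parameter `s`: `X₁` is `1` with probability `s` and `-1` with probability `1 - s`,
and, conditionally on `X₁, …, Xₙ`, an index `k` is chosen uniformly in `{1, …, n}` and `Xₙ₊₁` is
`Xₖ`, `-Xₖ` or `0` with probability `p`, `q`, `r` respectively. (`X 0` plays no role.) -/
structure IsERWS {Ω : Type*} [MeasurableSpace Ω] (μ : Measure Ω) (p q r s : ℝ)
    (X : ℕ → Ω → ℝ) : Prop where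
  measurable : ∀ n, Measurable (X n)
  first_pos : μ.real {ω | X 1 ω = 1} = s
  first_neg : μ.real {ω | X 1 ω = -1} = 1 - s
  step : ∀ n : ℕ, 1 ≤ n → ∀ y : ℝ,
    μ[({ω | X (n + 1) ω = y}).indicator (fun _ => (1 : ℝ)) | stepHistory X n]
      =ᵐ[μ] fun ω => (1 / (n : ℝ)) * ∑ k ∈ Finset.Icc 1 n, recallProb p q r (X k ω) y

/-- The position `Sₙ = X₁ + ⋯ + Xₙ`, with `S₀ = 0`. -/
def position {Ω : Type*} (X : ℕ → Ω → ℝ) (n : ℕ) (ω : Ω) : ℝ :=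
  ∑ k ∈ Finset.Icc 1 n, X k ω

/-- `L` is the almost sure limit of `Sₙ / n ^ (2p + r - 1)`. -/
def IsSuperdiffusiveLimit {Ω : Type*} [MeasurableSpace Ω] (μ : Measure Ω) (p r : ℝ)
    (X : ℕ → Ω → ℝ) (L : Ω → ℝ) : Prop :=
  ∀ᵐ ω ∂μ, Tendsto (fun n : ℕ => position X n ω / (n : ℝ) ^ (2 * p + r - 1)) atTop (𝓝 (L ω))

end

/-! Write `S` for the position and `N` for the number of moves. Given the past, the next step has
mean `(p - q) S / n` and second moment `(p + q) N / n`. Hence `S` divided by the product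
`gammaGrowth (p - q)` is a martingale, and, since `x ^ 3 = x` for `x ∈ {1, -1, 0}`, the moments
`E[S^i N^j]` satisfy a closed triangular system of linear recursions.

Each recursion has the form `a (n+1) = (1 + ρ/n) a n + (source)/n`, with a source built from
products `gammaGrowth y`. Such a term `c * gammaGrowth y` contributes `c / (y - ρ) * gammaGrowth y`,
and the value at time `1` fixes the coefficient of `gammaGrowth ρ`. By Euler's formula `gammaGrowth
ρ n` is asymptotic to `n ^ ρ / (ρ Γ(ρ))`. Superdiffusivity means `p > 3q`, which makes `k (p - q)`
the largest exponent in the `k`-th moment for `k ≤ 4`.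

The fourth moments of the martingale therefore converge. This bounds it in `L⁴`, gives an almost
sure limit, and carries all four moments over to that limit
(`Martingale.exists_limit_of_tendsto_integral_pow_four`). -/

/-! ### Convergence of integrals and of `L⁴`-bounded martingales -/

/-- Fatou's lemma for Bochner integrals of nonnegative functions. -/
lemma integral_le_of_tendsto_of_nonneg {Ω : Type*} [MeasurableSpace Ω] {μ : Measure Ω}
    {f : ℕ → Ω → ℝ} {g : Ω → ℝ} {l : ℝ} (hf : ∀ n, Integrable (f n) μ) (hg : Integrable g μ)
    (hf0 : ∀ n, 0 ≤ᵐ[μ] f n) (hlim : ∀ᵐ ω ∂μ, Tendsto (fun n => f n ω) atTop (𝓝 (g ω)))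
    (hl : Tendsto (fun n => ∫ ω, f n ω ∂μ) atTop (𝓝 l)) : ∫ ω, g ω ∂μ ≤ l := by
  have hg0 : 0 ≤ᵐ[μ] g := by
    filter_upwards [hlim, ae_all_iff.2 hf0] with ω h h0
    exact ge_of_tendsto' h h0
  have hl0 : 0 ≤ l := ge_of_tendsto' hl fun n => integral_nonneg_of_ae (hf0 n)
  rw [← ENNReal.ofReal_le_ofReal_iff hl0, ofReal_integral_eq_lintegral_ofReal hg hg0]
  calc ∫⁻ ω, ENNReal.ofReal (g ω) ∂μ
      = ∫⁻ ω, liminf (fun n => ENNReal.ofReal (f n ω)) atTop ∂μ := by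
        refine lintegral_congr_ae ?_
        filter_upwards [hlim] with ω h
        exact (((ENNReal.continuous_ofReal.tendsto _).comp h).liminf_eq).symm
    _ ≤ liminf (fun n => ∫⁻ ω, ENNReal.ofReal (f n ω) ∂μ) atTop :=
        lintegral_liminf_le' fun n => (hf n).aemeasurable.ennreal_ofReal
    _ = ENNReal.ofReal l := by
        have : Tendsto (fun n => ENNReal.ofReal (∫ ω, f n ω ∂μ)) atTop (𝓝 (ENNReal.ofReal l)) :=
          (ENNReal.continuous_ofReal.tendsto _).comp hl
        rw [← this.liminf_eq]
        congr 1
        ext n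
        rw [ofReal_integral_eq_lintegral_ofReal (hf n) (hf0 n)]

/-- Pratt's lemma: dominated convergence with convergent dominating functions. -/
lemma tendsto_integral_of_abs_le_of_tendsto {Ω : Type*} [MeasurableSpace Ω] {μ : Measure Ω}
    {f b : ℕ → Ω → ℝ} {g c : Ω → ℝ} (hf : ∀ n, Integrable (f n) μ) (hg : Integrable g μ)
    (hb : ∀ n, Integrable (b n) μ) (hc : Integrable c μ)
    (hfb : ∀ n ω, |f n ω| ≤ b n ω)
    (hfg : ∀ᵐ ω ∂μ, Tendsto (fun n => f n ω) atTop (𝓝 (g ω)))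
    (hbc : ∀ᵐ ω ∂μ, Tendsto (fun n => b n ω) atTop (𝓝 (c ω)))
    (hlim : Tendsto (fun n => ∫ ω, b n ω ∂μ) atTop (𝓝 (∫ ω, c ω ∂μ))) :
    Tendsto (fun n => ∫ ω, f n ω ∂μ) atTop (𝓝 (∫ ω, g ω ∂μ)) := by
  have hbound : ∀ n, |∫ ω, f n ω ∂μ| ≤ ∫ ω, b n ω ∂μ := fun n =>
    (abs_integral_le_integral_abs).trans (integral_mono (hf n).abs (hb n) (hfb n))
  obtain ⟨B, hB⟩ := hlim.bddAbove_range
  refine tendsto_of_subseq_tendsto fun ns hns => ?_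
  have hmem : ∀ n, (∫ ω, f (ns n) ω ∂μ) ∈ Set.Icc (-B) B := fun n => by
    have h1 := abs_le.1 ((hbound (ns n)).trans (hB ⟨ns n, rfl⟩))
    exact ⟨h1.1, h1.2⟩
  obtain ⟨l, -, φ, hφ, hl⟩ := isCompact_Icc.tendsto_subseq hmem
  refine ⟨φ, ?_⟩
  have hsub : Tendsto (fun n => ns (φ n)) atTop atTop := hns.comp hφ.tendsto_atTop
  have hbl := hlim.comp hsub
  -- Fatou applied to `b - f` gives `l ≤ ∫ g`; applied to `b + f` below it gives `∫ g ≤ l`. So every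
  -- subsequential limit is `∫ g`.
  have hupper := integral_le_of_tendsto_of_nonneg (μ := μ)
    (f := fun n ω => b (ns (φ n)) ω - f (ns (φ n)) ω) (g := fun ω => c ω - g ω)
    (l := ∫ ω, c ω ∂μ - l) (fun n => (hb _).sub (hf _)) (hc.sub hg)
    (fun n => Eventually.of_forall fun ω => sub_nonneg.2 ((le_abs_self _).trans (hfb _ ω)))
    (by filter_upwards [hfg, hbc] with ω h1 h2 using (h2.comp hsub).sub (h1.comp hsub))
    ((hbl.sub hl).congr fun n => (integral_sub (hb _) (hf _)).symm)
  have hlower := integral_le_of_tendsto_of_nonneg (μ := μ)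
    (f := fun n ω => b (ns (φ n)) ω + f (ns (φ n)) ω) (g := fun ω => c ω + g ω)
    (l := ∫ ω, c ω ∂μ + l) (fun n => (hb _).add (hf _)) (hc.add hg)
    (fun n => Eventually.of_forall fun ω => by
      have := (abs_le.1 (hfb (ns (φ n)) ω)).1
      simp only [Pi.zero_apply]; linarith)
    (by filter_upwards [hfg, hbc] with ω h1 h2 using (h2.comp hsub).add (h1.comp hsub))
    ((hbl.add hl).congr fun n => (integral_add (hb _) (hf _)).symm)
  rw [integral_sub hc hg] at hupper
  rw [integral_add hc hg] at hlower
  have : l = ∫ ω, g ω ∂μ := by linarith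
  rw [← this]
  exact hl

/-- A family of real functions that is bounded in `L²` is uniformly integrable. -/
lemma uniformIntegrable_one_of_integral_sq_le {Ω ι : Type*} [MeasurableSpace Ω] {μ : Measure Ω}
    [IsProbabilityMeasure μ] {f : ι → Ω → ℝ} {B : ℝ} (hf : ∀ i, MemLp (f i) 2 μ)
    (hB : ∀ i, ∫ ω, f i ω ^ 2 ∂μ ≤ B) : UniformIntegrable f 1 μ := by
  refine uniformIntegrable_of le_rfl ENNReal.one_ne_top (fun i => (hf i).1) fun ε hε => ?_
  have hε' : 0 < ε := hε
  -- On `{|f| ≥ K}` one has `|f| ≤ f² / K`, so the tail is at most `B / K ≤ ε`; the `+ 1` keeps `K`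
  -- positive when `B = 0`.
  set K : ℝ := (|B| + 1) / ε with hK
  have hK0 : 0 < K := by positivity
  refine ⟨K.toNNReal, fun i => ?_⟩
  have hi2 : Integrable (fun ω => f i ω ^ 2) μ := (hf i).integrable_sq
  rw [eLpNorm_one_eq_lintegral_enorm]
  calc ∫⁻ ω, ‖{x | K.toNNReal ≤ ‖f i x‖₊}.indicator (f i) ω‖ₑ ∂μ
      ≤ ∫⁻ ω, ENNReal.ofReal (f i ω ^ 2 / K) ∂μ := by
        refine lintegral_mono fun ω => ?_
        by_cases h : ω ∈ {x | K.toNNReal ≤ ‖f i x‖₊}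
        · rw [Set.indicator_of_mem h, Real.enorm_eq_ofReal_abs]
          refine ENNReal.ofReal_le_ofReal ?_
          have h' : K ≤ |f i ω| := by
            have : K.toNNReal ≤ ‖f i ω‖₊ := h
            rw [Real.toNNReal_le_iff_le_coe] at this
            simpa using this
          rw [le_div_iff₀ hK0, ← sq_abs, sq]
          exact mul_le_mul_of_nonneg_left h' (abs_nonneg _)
        · rw [Set.indicator_of_notMem h]; simp
    _ = ENNReal.ofReal (∫ ω, f i ω ^ 2 / K ∂μ) :=
        (ofReal_integral_eq_lintegral_ofReal (hi2.div_const K)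
          (Eventually.of_forall fun ω => by simp only [Pi.zero_apply]; positivity)).symm
    _ ≤ ENNReal.ofReal ε := by
        refine ENNReal.ofReal_le_ofReal ?_
        rw [integral_div, div_le_iff₀ hK0, hK, mul_div_cancel₀ _ hε'.ne']
        linarith [hB i, le_abs_self B]

lemma Real.abs_pow_four (x : ℝ) : |x| ^ 4 = x ^ 4 := Even.pow_abs (by decide) x

/-- Supplies the dominating function `1 + x ^ 4` through which the fourth moment controls the lower
ones. -/
lemma abs_pow_le_one_add_pow_four (x : ℝ) {k : ℕ} (hk : k ≤ 4) : |x ^ k| ≤ 1 + x ^ 4 := by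
  rw [abs_pow, ← Real.abs_pow_four x]
  rcases le_total |x| 1 with h | h
  · have := pow_le_one₀ (n := k) (abs_nonneg x) h
    have : 0 ≤ |x| ^ 4 := by positivity
    linarith
  · have := pow_le_pow_right₀ h hk
    linarith

/-- A martingale whose fourth moments converge has an almost sure limit in `L⁴`, and all moments
up to the fourth converge to those of the limit. -/
theorem MeasureTheory.Martingale.exists_limit_of_tendsto_integral_pow_four {Ω : Type*}
    {m0 : MeasurableSpace Ω} {μ : Measure Ω} [IsProbabilityMeasure μ] {ℱ : Filtration ℕ m0}
    {M : ℕ → Ω → ℝ} (hM : Martingale M ℱ μ) (hM4 : ∀ n, MemLp (M n) 4 μ) {l : ℝ}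
    (hl : Tendsto (fun n => ∫ ω, M n ω ^ 4 ∂μ) atTop (𝓝 l)) :
    ∃ L : Ω → ℝ, Measurable L ∧ MemLp L 4 μ ∧
      (∀ᵐ ω ∂μ, Tendsto (fun n => M n ω) atTop (𝓝 (L ω))) ∧
      ∀ k ≤ 4, Tendsto (fun n => ∫ ω, M n ω ^ k ∂μ) atTop (𝓝 (∫ ω, L ω ^ k ∂μ)) := by
  obtain ⟨B, hB⟩ := hl.bddAbove_range
  have hB' : ∀ n, ∫ ω, M n ω ^ 4 ∂μ ≤ B := fun n => hB ⟨n, rfl⟩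
  have hint4 : ∀ {f : Ω → ℝ}, MemLp f 4 μ → Integrable (fun ω => f ω ^ 4) μ := fun {f} hf => by
    simpa using (hf.integrable_norm_pow (p := 4) (by norm_num)).congr
      (Eventually.of_forall fun ω => by simp [Real.abs_pow_four])
  have hintk : ∀ {f : Ω → ℝ}, MemLp f 4 μ → ∀ k ≤ 4, Integrable (fun ω => f ω ^ k) μ := by
    intro f hf k hk
    refine ((integrable_const (1 : ℝ)).add (hint4 hf)).mono' (hf.1.pow k) ?_
    exact Eventually.of_forall fun ω => abs_pow_le_one_add_pow_four _ hk
  have hM2 : ∀ n, ∫ ω, M n ω ^ 2 ∂μ ≤ 1 + B := fun n => by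
    calc ∫ ω, M n ω ^ 2 ∂μ ≤ ∫ ω, (1 + M n ω ^ 4) ∂μ :=
          integral_mono (hintk (hM4 n) 2 (by norm_num))
            ((integrable_const (1 : ℝ)).add (hint4 (hM4 n)))
            fun ω => (le_abs_self _).trans (abs_pow_le_one_add_pow_four _ (by norm_num))
      _ = 1 + ∫ ω, M n ω ^ 4 ∂μ := by
          rw [integral_add (integrable_const _) (hint4 (hM4 n))]; simp
      _ ≤ 1 + B := by linarith [hB' n]
  have hUI : UniformIntegrable M 1 μ := uniformIntegrable_one_of_integral_sq_le
    (fun n => (hM4 n).mono_exponent (by norm_num)) hM2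
  set L := Filtration.limitProcess M ℱ μ
  have hlim : ∀ᵐ ω ∂μ, Tendsto (fun n => M n ω) atTop (𝓝 (L ω)) :=
    hM.submartingale.ae_tendsto_limitProcess_of_uniformIntegrable hUI
  have hcond : ∀ n, M n =ᵐ[μ] μ[L | ℱ n] := fun n => hM.ae_eq_condExp_limitProcess hUI n
  have hnorm : ∀ n, eLpNorm (M n) 4 μ ≤ ((B ^ (1 / 4 : ℝ)).toNNReal : ENNReal) := fun n => by
    rw [(hM4 n).eLpNorm_eq_integral_rpow_norm (by norm_num) (by norm_num)]
    refine ENNReal.ofReal_le_ofReal ?_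
    have : ∀ ω, ‖M n ω‖ ^ (4 : ENNReal).toReal = M n ω ^ 4 := fun ω => by
      rw [show (4 : ENNReal).toReal = ((4 : ℕ) : ℝ) by simp, Real.rpow_natCast, Real.norm_eq_abs, Real.abs_pow_four]
    simp only [this]
    rw [show ((4 : ENNReal).toReal)⁻¹ = (1 / 4 : ℝ) by simp]
    exact Real.rpow_le_rpow (integral_nonneg fun ω => by positivity) (hB' n) (by norm_num)
  have hL4 : MemLp L 4 μ := hM.submartingale.memLp_limitProcess hnorm
  have hup : ∫ ω, L ω ^ 4 ∂μ ≤ l :=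
    integral_le_of_tendsto_of_nonneg (fun n => hint4 (hM4 n)) (hint4 hL4)
      (fun n => Eventually.of_forall fun ω => by simp only [Pi.zero_apply]; positivity)
      (by filter_upwards [hlim] with ω h using h.pow 4) hl
  -- Fatou gave one inequality. The other is conditional Jensen, since uniform integrability closes
  -- the martingale: `M n = E[L | ℱ n]`.
  have hlow : ∀ n, ∫ ω, M n ω ^ 4 ∂μ ≤ ∫ ω, L ω ^ 4 ∂μ := fun n => by
    have h1 := integral_norm_condExp_rpow_le (μ := μ) (m := ℱ n) (p := ((4 : ℕ) : ℝ))
      (by norm_num) (f := L) (by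
        simp only [Real.rpow_natCast]
        simpa [Real.abs_pow_four] using hint4 hL4)
    simp only [Real.rpow_natCast, Real.norm_eq_abs, Real.abs_pow_four] at h1
    have h2 : ∫ ω, M n ω ^ 4 ∂μ = ∫ ω, (μ[L | ℱ n]) ω ^ 4 ∂μ := by
      refine integral_congr_ae ?_
      filter_upwards [hcond n] with ω h
      rw [h]
    rwa [h2]
  have heq : ∫ ω, L ω ^ 4 ∂μ = l := le_antisymm hup (le_of_tendsto' hl hlow)
  refine ⟨L, ?_, hL4, hlim, fun k hk => ?_⟩
  · exact Filtration.stronglyMeasurable_limit_process'.measurable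
  refine tendsto_integral_of_abs_le_of_tendsto (b := fun n ω => 1 + M n ω ^ 4)
    (c := fun ω => 1 + L ω ^ 4) (fun n => hintk (hM4 n) k hk) (hintk hL4 k hk)
    (fun n => (integrable_const (1 : ℝ)).add (hint4 (hM4 n)))
    ((integrable_const (1 : ℝ)).add (hint4 hL4))
    (fun n ω => abs_pow_le_one_add_pow_four _ hk)
    (by filter_upwards [hlim] with ω h using h.pow k)
    (by filter_upwards [hlim] with ω h using (h.pow 4).const_add 1) ?_
  have h1 : ∀ {f : Ω → ℝ}, MemLp f 4 μ → ∫ ω, (1 + f ω ^ 4) ∂μ = 1 + ∫ ω, f ω ^ 4 ∂μ :=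
    fun hf => by rw [integral_add (integrable_const _) (hint4 hf)]; simp
  simp only [h1 hL4, h1 (hM4 _), heq]
  exact hl.const_add 1

/-! ### Gamma products and their growth -/

/-- The product `∏_{k=1}^{n} (1 + x / k)`, which equals `Γ(n+1+x) / (Γ(n+1) Γ(1+x))`. -/
noncomputable def gammaGrowth (x : ℝ) (n : ℕ) : ℝ := ∏ k ∈ Finset.range n, (1 + x / ((k : ℝ) + 1))

lemma gammaGrowth_zero (x : ℝ) : gammaGrowth x 0 = 1 := by simp [gammaGrowth]

lemma gammaGrowth_succ (x : ℝ) (n : ℕ) :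
    gammaGrowth x (n + 1) = gammaGrowth x n * (1 + x / ((n : ℝ) + 1)) :=
  Finset.prod_range_succ _ _

lemma gammaGrowth_pos {x : ℝ} (hx : 0 < x) (n : ℕ) : 0 < gammaGrowth x n :=
  Finset.prod_pos fun k _ => by positivity

/-- Puts the product in the form of the denominator of Euler's sequence `Real.GammaSeq`. -/
lemma gammaGrowth_mul_factorial {x : ℝ} (n : ℕ) :
    gammaGrowth x n * (x * (n.factorial : ℝ)) = ∏ j ∈ Finset.range (n + 1), (x + j) := by
  induction n with
  | zero => simp [gammaGrowth_zero]
  | succ n ih =>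
    rw [Finset.prod_range_succ, ← ih, gammaGrowth_succ, Nat.factorial_succ]
    push_cast
    field_simp
    ring

lemma tendsto_gammaGrowth_div_rpow {x : ℝ} (hx : 0 < x) :
    Tendsto (fun n : ℕ => gammaGrowth x n / ((n + 1 : ℕ) : ℝ) ^ x) atTop
      (𝓝 (1 / (x * Real.Gamma x))) := by
  have h1 : Tendsto (fun n : ℕ => ((n : ℝ) / ((n : ℝ) + 1)) ^ x) atTop (𝓝 1) := by
    have := (tendsto_natCast_div_add_atTop (1 : ℝ)).rpow_const (p := x) (Or.inl one_ne_zero)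
    simpa using this
  have h2 : Tendsto (fun n : ℕ => ((n : ℝ) / ((n : ℝ) + 1)) ^ x * (1 / (x * Real.GammaSeq x n)))
      atTop (𝓝 (1 * (1 / (x * Real.Gamma x)))) :=
    h1.mul (tendsto_const_nhds.div ((Real.GammaSeq_tendsto_Gamma x).const_mul x)
      (mul_pos hx (Real.Gamma_pos_of_pos hx)).ne')
  rw [one_mul] at h2
  refine h2.congr' ?_
  filter_upwards [eventually_ge_atTop 1] with n hn
  have hn0 : (0 : ℝ) < n := by exact_mod_cast hn
  rw [Real.GammaSeq, ← gammaGrowth_mul_factorial, Real.div_rpow hn0.le (by positivity)]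
  have h3 := gammaGrowth_pos hx n
  have h4 : (0 : ℝ) < (n : ℝ) ^ x := by positivity
  have h5 : (0 : ℝ) < ((n : ℝ) + 1) ^ x := by positivity
  have h6 : (0 : ℝ) < (n.factorial : ℝ) := by positivity
  push_cast
  field_simp

/-- Discards the lower-order terms of the explicit moment formulas. -/
lemma tendsto_gammaGrowth_div_rpow_zero {x y : ℝ} (hx : 0 < x) (hxy : x < y) :
    Tendsto (fun n : ℕ => gammaGrowth x n / ((n + 1 : ℕ) : ℝ) ^ y) atTop (𝓝 0) := by
  have h1 : Tendsto (fun n : ℕ => ((n + 1 : ℕ) : ℝ) ^ (-(y - x))) atTop (𝓝 0) :=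
    ((tendsto_rpow_neg_atTop (sub_pos.2 hxy)).comp tendsto_natCast_atTop_atTop).comp
      (tendsto_add_atTop_nat 1)
  have h2 := (tendsto_gammaGrowth_div_rpow hx).mul h1
  rw [mul_zero] at h2
  refine h2.congr fun n => ?_
  have h3 : (0 : ℝ) < ((n + 1 : ℕ) : ℝ) := by positivity
  rw [neg_sub, Real.rpow_sub h3]
  have h4 := Real.rpow_pos_of_pos h3 x
  field_simp

/-! ### One-step law and conditional moments -/

lemma recallProb_sum_identities {p q r x : ℝ} (hx : x = 1 ∨ x = -1 ∨ x = 0) :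
    recallProb p q r x 1 - recallProb p q r x (-1) = (p - q) * x ∧
    recallProb p q r x 1 + recallProb p q r x (-1) = (p + q) * x ^ 2 ∧
    recallProb p q r x 1 + recallProb p q r x (-1) + recallProb p q r x 0 = p + q + r := by
  rcases hx with rfl | rfl | rfl <;> refine ⟨?_, ?_, ?_⟩ <;> norm_num [recallProb] <;> ring

section
variable {Ω : Type*}

/-- The number of moves `X₁² + ⋯ + Xₙ²` among the first `n` steps. -/
def moveCount (X : ℕ → Ω → ℝ) (n : ℕ) (ω : Ω) : ℝ := ∑ k ∈ Finset.Icc 1 n, X k ω ^ 2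

lemma position_succ (X : ℕ → Ω → ℝ) (n : ℕ) (ω : Ω) :
    position X (n + 1) ω = position X n ω + X (n + 1) ω :=
  Finset.sum_Icc_succ_top (by omega) _

lemma moveCount_succ (X : ℕ → Ω → ℝ) (n : ℕ) (ω : Ω) :
    moveCount X (n + 1) ω = moveCount X n ω + X (n + 1) ω ^ 2 :=
  Finset.sum_Icc_succ_top (by omega) _

lemma measurable_stepHistory (X : ℕ → Ω → ℝ) {k n : ℕ} (hk : k ∈ Finset.Icc 1 n) :
    Measurable[stepHistory X n] (X k) :=
  (comap_measurable (X k)).mono (le_iSup₂_of_le k hk le_rfl) le_rfl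

lemma measurable_position (X : ℕ → Ω → ℝ) (n : ℕ) :
    Measurable[stepHistory X n] (position X n) := by
  let _ := stepHistory X n
  exact Finset.measurable_fun_sum _ fun k hk => measurable_stepHistory X hk

lemma measurable_moveCount (X : ℕ → Ω → ℝ) (n : ℕ) :
    Measurable[stepHistory X n] (moveCount X n) := by
  let _ := stepHistory X n
  exact Finset.measurable_fun_sum _ fun k hk => (measurable_stepHistory X hk).pow_const 2

/-- The monomial `Sₙ^i Nₙ^j Xₙ₊₁^k`. -/
def stepMonomial (X : ℕ → Ω → ℝ) (n i j k : ℕ) (ω : Ω) : ℝ :=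
  position X n ω ^ i * moveCount X n ω ^ j * X (n + 1) ω ^ k

/-- The joint moment `E[Sₙ^i Nₙ^j]`. -/
noncomputable def jointMoment [MeasurableSpace Ω] (μ : Measure Ω) (X : ℕ → Ω → ℝ) (i j n : ℕ) : ℝ :=
  ∫ ω, position X n ω ^ i * moveCount X n ω ^ j ∂μ

lemma integral_stepMonomial_zero [MeasurableSpace Ω] (μ : Measure Ω) (X : ℕ → Ω → ℝ) (n i j : ℕ) :
    ∫ ω, stepMonomial X n i j 0 ω ∂μ = jointMoment μ X i j n := by
  simp [stepMonomial, jointMoment]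

end

section
variable {Ω : Type*} [m0 : MeasurableSpace Ω] {μ : Measure Ω} {p q r s : ℝ} {X : ℕ → Ω → ℝ}

lemma IsERWS.stepHistory_le (hX : IsERWS μ p q r s X) (n : ℕ) : stepHistory X n ≤ m0 :=
  iSup₂_le fun k _ => (hX.measurable k).comap_le

variable [IsProbabilityMeasure μ]

lemma integrable_stepIndicator (hX : IsERWS μ p q r s X) (n : ℕ) (y : ℝ) :
    Integrable (({ω | X n ω = y}).indicator (fun _ => (1 : ℝ))) μ :=
  (integrable_const _).indicator (hX.measurable n (measurableSet_singleton y))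

/-- If the indicators of three values of a random variable have total mean `1`, the variable
almost surely takes one of these values. -/
lemma ae_mem_of_integral_indicator_eq_one {Y : Ω → ℝ} (hY : Measurable Y)
    (h : ∫ ω, ({ω | Y ω = 1}).indicator (fun _ => (1 : ℝ)) ω ∂μ
      + ∫ ω, ({ω | Y ω = -1}).indicator (fun _ => (1 : ℝ)) ω ∂μ
      + ∫ ω, ({ω | Y ω = 0}).indicator (fun _ => (1 : ℝ)) ω ∂μ = 1) :
    ∀ᵐ ω ∂μ, Y ω = 1 ∨ Y ω = -1 ∨ Y ω = 0 := by
  have hY' : ∀ y, MeasurableSet {ω | Y ω = y} := fun y => hY (measurableSet_singleton y)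
  have hdisj : ∀ {x y : ℝ}, x ≠ y → Disjoint {ω | Y ω = x} {ω | Y ω = y} := fun hxy =>
    Set.disjoint_left.2 fun ω (h1 : Y ω = _) (h2 : Y ω = _) => hxy (h1.symm.trans h2)
  simp only [integral_indicator_const _ (hY' _), smul_eq_mul, mul_one] at h
  rw [← measureReal_union (hdisj (by norm_num)) (hY' _),
    ← measureReal_union ((hdisj (by norm_num)).union_left (hdisj (by norm_num))) (hY' _),
    measureReal_def, ENNReal.toReal_eq_one_iff] at h
  filter_upwards [(mem_ae_iff_prob_eq_one (((hY' _).union (hY' _)).union (hY' _))).2 h] with ω hω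
  exact or_assoc.1 hω

lemma IsERWS.ae_first_step (hX : IsERWS μ p q r s X) : ∀ᵐ ω ∂μ, X 1 ω = 1 ∨ X 1 ω = -1 := by
  have hY : ∀ y, MeasurableSet {ω | X 1 ω = y} :=
    fun y => hX.measurable 1 (measurableSet_singleton y)
  have hdisj : Disjoint {ω | X 1 ω = 1} {ω | X 1 ω = -1} :=
    Set.disjoint_left.2 fun ω (h1 : X 1 ω = _) (h2 : X 1 ω = _) => by linarith
  have h1 : μ.real ({ω | X 1 ω = 1} ∪ {ω | X 1 ω = -1}) = 1 := by
    rw [measureReal_union hdisj (hY _), hX.first_pos, hX.first_neg]; ring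
  rw [measureReal_def, ENNReal.toReal_eq_one_iff] at h1
  exact (mem_ae_iff_prob_eq_one ((hY _).union (hY _))).2 h1

/-- The support is not part of the model's definition. By strong induction, once the earlier steps
lie in `{1, -1, 0}`, the conditional probabilities of these three values add up to `p + q + r = 1`.
-/
lemma IsERWS.ae_step_mem (hX : IsERWS μ p q r s X) (hpqr : p + q + r = 1) :
    ∀ᵐ ω ∂μ, ∀ n, 1 ≤ n → (X n ω = 1 ∨ X n ω = -1 ∨ X n ω = 0) := by
  suffices h : ∀ n, 1 ≤ n → ∀ᵐ ω ∂μ, (X n ω = 1 ∨ X n ω = -1 ∨ X n ω = 0) by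
    rw [ae_all_iff]
    intro n
    by_cases hn : 1 ≤ n
    · filter_upwards [h n hn] with ω hω _ using hω
    · exact Eventually.of_forall fun ω h => absurd h hn
  intro n
  induction n using Nat.strong_induction_on with
  | _ n ih =>
  intro hn
  obtain rfl | ⟨m, hm, rfl⟩ : n = 1 ∨ ∃ m, 1 ≤ m ∧ n = m + 1 := by
    rcases Nat.lt_or_ge 1 n with h | h
    · exact Or.inr ⟨n - 1, by omega, by omega⟩
    · exact Or.inl (by omega)
  · exact hX.ae_first_step.mono fun ω h => h.imp_right Or.inl
  · refine ae_mem_of_integral_indicator_eq_one (hX.measurable _) ?_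
    have hstep : ∀ y, ∫ ω, ({ω | X (m + 1) ω = y}).indicator (fun _ => (1 : ℝ)) ω ∂μ
        = ∫ ω, (μ[({ω | X (m + 1) ω = y}).indicator (fun _ => (1 : ℝ)) | stepHistory X m]) ω ∂μ :=
      fun y => (integral_condExp (hX.stepHistory_le m)).symm
    rw [hstep, hstep, hstep, ← integral_add integrable_condExp integrable_condExp,
      ← integral_add (integrable_condExp.add integrable_condExp) integrable_condExp]
    have hprev : ∀ᵐ ω ∂μ, ∀ k ∈ Finset.Icc 1 m, (X k ω = 1 ∨ X k ω = -1 ∨ X k ω = 0) := by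
      rw [Finset.eventually_all]
      intro k hk
      rw [Finset.mem_Icc] at hk
      exact ih k (by omega) hk.1
    have hm0 : (m : ℝ) ≠ 0 := by positivity
    have : (fun ω => (μ[({ω | X (m + 1) ω = 1}).indicator (fun _ => (1 : ℝ)) | stepHistory X m]) ω
        + (μ[({ω | X (m + 1) ω = -1}).indicator (fun _ => (1 : ℝ)) | stepHistory X m]) ω
        + (μ[({ω | X (m + 1) ω = 0}).indicator (fun _ => (1 : ℝ)) | stepHistory X m]) ω)
        =ᵐ[μ] fun _ => (1 : ℝ) := by
      filter_upwards [hX.step m hm 1, hX.step m hm (-1), hX.step m hm 0, hprev]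
        with ω h1 h2 h3 h4
      rw [h1, h2, h3, ← mul_add, ← mul_add, ← Finset.sum_add_distrib, ← Finset.sum_add_distrib,
        Finset.sum_congr rfl fun k hk => (recallProb_sum_identities (h4 k hk)).2.2, hpqr]
      simp [hm0]
    rw [integral_congr_ae this]
    simp

/-- Conditional first and second moments of the next step given the past. -/
lemma IsERWS.condExp_step (hX : IsERWS μ p q r s X) (hpqr : p + q + r = 1) {n : ℕ} (hn : 1 ≤ n) :
    μ[X (n + 1) | stepHistory X n] =ᵐ[μ] (fun ω => (p - q) / n * position X n ω) ∧
    μ[fun ω => X (n + 1) ω ^ 2 | stepHistory X n] =ᵐ[μ]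
      (fun ω => (p + q) / n * moveCount X n ω) := by
  have hmem := hX.ae_step_mem hpqr
  constructor
  · have h1 : X (n + 1) =ᵐ[μ] ({ω | X (n + 1) ω = 1}).indicator (fun _ => (1 : ℝ))
        - ({ω | X (n + 1) ω = -1}).indicator (fun _ => (1 : ℝ)) := by
      filter_upwards [hmem] with ω h
      simp only [Pi.sub_apply, Set.indicator_apply, Set.mem_ofPred_eq]
      rcases h (n + 1) (by omega) with h | h | h <;> norm_num [h]
    filter_upwards [condExp_congr_ae (m := stepHistory X n) h1,
      condExp_sub (integrable_stepIndicator hX (n + 1) 1) (integrable_stepIndicator hX (n + 1) (-1))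
        (stepHistory X n), hX.step n hn 1, hX.step n hn (-1), hmem] with ω e1 e2 e3 e4 e5
    rw [e1, e2, Pi.sub_apply, e3, e4, ← mul_sub, ← Finset.sum_sub_distrib,
      Finset.sum_congr rfl fun k hk =>
        (recallProb_sum_identities (e5 k (Finset.mem_Icc.1 hk).1)).1, ← Finset.mul_sum, position]
    ring
  · have h1 : (fun ω => X (n + 1) ω ^ 2) =ᵐ[μ] ({ω | X (n + 1) ω = 1}).indicator (fun _ => (1 : ℝ))
        + ({ω | X (n + 1) ω = -1}).indicator (fun _ => (1 : ℝ)) := by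
      filter_upwards [hmem] with ω h
      simp only [Pi.add_apply, Set.indicator_apply, Set.mem_ofPred_eq]
      rcases h (n + 1) (by omega) with h | h | h <;> norm_num [h]
    filter_upwards [condExp_congr_ae (m := stepHistory X n) h1,
      condExp_add (integrable_stepIndicator hX (n + 1) 1) (integrable_stepIndicator hX (n + 1) (-1))
        (stepHistory X n), hX.step n hn 1, hX.step n hn (-1), hmem] with ω e1 e2 e3 e4 e5
    rw [e1, e2, Pi.add_apply, e3, e4, ← mul_add, ← Finset.sum_add_distrib,
      Finset.sum_congr rfl fun k hk =>
        (recallProb_sum_identities (e5 k (Finset.mem_Icc.1 hk).1)).2.1, ← Finset.mul_sum, moveCount]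
    ring

lemma IsERWS.ae_abs_le (hX : IsERWS μ p q r s X) (hpqr : p + q + r = 1) :
    ∀ᵐ ω ∂μ, ∀ n, |position X n ω| ≤ n ∧ |moveCount X n ω| ≤ n ∧ |X (n + 1) ω| ≤ 1 := by
  filter_upwards [hX.ae_step_mem hpqr] with ω h n
  have hle : ∀ k, 1 ≤ k → |X k ω| ≤ 1 := fun k hk => by
    rcases h k hk with h | h | h <;> norm_num [h]
  refine ⟨?_, ?_, hle _ (by omega)⟩
  · refine (Finset.abs_sum_le_sum_abs _ _).trans ((Finset.sum_le_card_nsmul _ _ 1 fun k hk =>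
      hle k (Finset.mem_Icc.1 hk).1).trans ?_)
    simp
  · refine (Finset.abs_sum_le_sum_abs _ _).trans ((Finset.sum_le_card_nsmul _ _ 1 fun k hk => ?_).trans ?_)
    · rw [abs_pow]
      exact pow_le_one₀ (abs_nonneg _) (hle k (Finset.mem_Icc.1 hk).1)
    · simp

lemma IsERWS.integrable_stepMonomial (hX : IsERWS μ p q r s X) (hpqr : p + q + r = 1)
    (n i j k : ℕ) : Integrable (stepMonomial X n i j k) μ := by
  have hS := (measurable_position X n).mono (hX.stepHistory_le n) le_rfl
  have hN := (measurable_moveCount X n).mono (hX.stepHistory_le n) le_rfl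
  refine Integrable.of_bound (C := (n : ℝ) ^ i * (n : ℝ) ^ j * 1 ^ k)
    (((hS.pow_const i).mul (hN.pow_const j)).mul
      ((hX.measurable (n + 1)).pow_const k)).aestronglyMeasurable ?_
  filter_upwards [hX.ae_abs_le hpqr] with ω h
  obtain ⟨h1, h2, h3⟩ := h n
  rw [stepMonomial, Real.norm_eq_abs, abs_mul, abs_mul, abs_pow, abs_pow, abs_pow]
  gcongr

/-- `S` and `N` at time `n` are known from the past, so their powers come out of the conditional
expectation. -/
lemma IsERWS.integral_stepMonomial_of_condExp (hX : IsERWS μ p q r s X) (hpqr : p + q + r = 1)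
    {n k : ℕ} {Y : Ω → ℝ}
    (hY : μ[fun ω => X (n + 1) ω ^ k | stepHistory X n] =ᵐ[μ] Y) (i j : ℕ) :
    ∫ ω, stepMonomial X n i j k ω ∂μ
      = ∫ ω, position X n ω ^ i * moveCount X n ω ^ j * Y ω ∂μ := by
  have hS := measurable_position X n
  have hN := measurable_moveCount X n
  have hW : Measurable[stepHistory X n]
      (fun ω => position X n ω ^ i * moveCount X n ω ^ j) := (hS.pow_const i).mul (hN.pow_const j)
  have h1 := condExp_mul_of_stronglyMeasurable_left (μ := μ) hW.stronglyMeasurable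
    (g := fun ω => X (n + 1) ω ^ k) (hX.integrable_stepMonomial hpqr n i j k)
    ((hX.integrable_stepMonomial hpqr n 0 0 k).congr (.of_forall fun ω => by simp [stepMonomial]))
  rw [← integral_condExp (hX.stepHistory_le n)]
  refine integral_congr_ae ?_
  filter_upwards [h1, hY] with ω e1 e2
  rw [← e2]
  exact e1

lemma IsERWS.integral_stepMonomial_one (hX : IsERWS μ p q r s X) (hpqr : p + q + r = 1)
    {n : ℕ} (hn : 1 ≤ n) (i j : ℕ) :
    ∫ ω, stepMonomial X n i j 1 ω ∂μ = (p - q) / n * jointMoment μ X (i + 1) j n := by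
  rw [hX.integral_stepMonomial_of_condExp hpqr (by simpa using (hX.condExp_step hpqr hn).1),
    jointMoment, ← integral_const_mul]
  congr 1; ext ω; ring

lemma IsERWS.integral_stepMonomial_two (hX : IsERWS μ p q r s X) (hpqr : p + q + r = 1)
    {n : ℕ} (hn : 1 ≤ n) (i j : ℕ) :
    ∫ ω, stepMonomial X n i j 2 ω ∂μ = (p + q) / n * jointMoment μ X i (j + 1) n := by
  rw [hX.integral_stepMonomial_of_condExp hpqr (hX.condExp_step hpqr hn).2,
    jointMoment, ← integral_const_mul]
  congr 1; ext ω; ring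

lemma IsERWS.integral_list_stepMonomial (hX : IsERWS μ p q r s X) (hpqr : p + q + r = 1)
    (n : ℕ) (l : List (ℝ × ℕ × ℕ × ℕ)) :
    Integrable (fun ω => (l.map fun t => t.1 * stepMonomial X n t.2.1 t.2.2.1 t.2.2.2 ω).sum) μ ∧
    ∫ ω, (l.map fun t => t.1 * stepMonomial X n t.2.1 t.2.2.1 t.2.2.2 ω).sum ∂μ
      = (l.map fun t => t.1 * ∫ ω, stepMonomial X n t.2.1 t.2.2.1 t.2.2.2 ω ∂μ).sum := by
  induction l with
  | nil => simp
  | cons t l ih =>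
    have h1 := (hX.integrable_stepMonomial hpqr n t.2.1 t.2.2.1 t.2.2.2).const_mul t.1
    simp only [List.map_cons, List.sum_cons]
    exact ⟨h1.add ih.1, by rw [integral_add h1 ih.1, ih.2, integral_const_mul]⟩

/-- Expansion of `E[Sₙ₊₁^i Nₙ₊₁^j]` along a polynomial identity that holds for steps `x = ±1, 0`. -/
lemma IsERWS.jointMoment_succ (hX : IsERWS μ p q r s X) (hpqr : p + q + r = 1)
    (n i j : ℕ) (l : List (ℝ × ℕ × ℕ × ℕ))
    (hl : ∀ S N x : ℝ, (x = 1 ∨ x = -1 ∨ x = 0) → (S + x) ^ i * (N + x ^ 2) ^ j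
      = (l.map fun t => t.1 * (S ^ t.2.1 * N ^ t.2.2.1 * x ^ t.2.2.2)).sum) :
    jointMoment μ X i j (n + 1)
      = (l.map fun t => t.1 * ∫ ω, stepMonomial X n t.2.1 t.2.2.1 t.2.2.2 ω ∂μ).sum := by
  rw [← (hX.integral_list_stepMonomial hpqr n l).2, jointMoment]
  refine integral_congr_ae ?_
  filter_upwards [hX.ae_step_mem hpqr] with ω h
  rw [position_succ, moveCount_succ, hl _ _ _ (h (n + 1) (by omega))]
  rfl

end

/-! ### Explicit joint moments -/

section
variable {Ω : Type*} [m0 : MeasurableSpace Ω] {μ : Measure Ω} [IsProbabilityMeasure μ]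
  {p q r s : ℝ} {X : ℕ → Ω → ℝ}

lemma IsERWS.integral_first_step (hX : IsERWS μ p q r s X) : ∫ ω, X 1 ω ∂μ = 2 * s - 1 := by
  have hY : ∀ y, MeasurableSet {ω | X 1 ω = y} :=
    fun y => hX.measurable 1 (measurableSet_singleton y)
  have h1 : X 1 =ᵐ[μ] fun ω => ({ω | X 1 ω = 1}).indicator (fun _ => (1 : ℝ)) ω
      - ({ω | X 1 ω = -1}).indicator (fun _ => (1 : ℝ)) ω := by
    filter_upwards [hX.ae_first_step] with ω h
    simp only [Set.indicator_apply, Set.mem_ofPred_eq]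
    rcases h with h | h <;> norm_num [h]
  rw [integral_congr_ae h1, integral_sub (integrable_stepIndicator hX 1 1) (integrable_stepIndicator hX 1 (-1)),
    integral_indicator_const _ (hY 1), integral_indicator_const _ (hY (-1)),
    smul_eq_mul, smul_eq_mul, hX.first_pos, hX.first_neg]
  ring

lemma IsERWS.jointMoment_one_of_even (hX : IsERWS μ p q r s X) {i : ℕ} (hi : Even i) (j : ℕ) :
    jointMoment μ X i j 1 = 1 := by
  have h : (fun ω => position X 1 ω ^ i * moveCount X 1 ω ^ j) =ᵐ[μ] fun _ => (1 : ℝ) := by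
    filter_upwards [hX.ae_first_step] with ω h
    rcases h with h | h <;> simp [position, moveCount, h, hi.neg_one_pow]
  rw [jointMoment, integral_congr_ae h]
  simp

lemma IsERWS.jointMoment_one_of_odd (hX : IsERWS μ p q r s X) {i : ℕ} (hi : Odd i) (j : ℕ) :
    jointMoment μ X i j 1 = 2 * s - 1 := by
  have h : (fun ω => position X 1 ω ^ i * moveCount X 1 ω ^ j) =ᵐ[μ] X 1 := by
    filter_upwards [hX.ae_first_step] with ω h
    rcases h with h | h <;> simp [position, moveCount, h, hi.neg_one_pow]
  rw [jointMoment, integral_congr_ae h, hX.integral_first_step]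

lemma IsERWS.jointMoment_one_zero (hX : IsERWS μ p q r s X) (hpqr : p + q + r = 1) (n : ℕ) :
    jointMoment μ X 1 0 (n + 1) = (2 * s - 1) * gammaGrowth (p - q) n := by
  induction n with
  | zero => simp [hX.jointMoment_one_of_odd odd_one, gammaGrowth_zero]
  | succ n ih =>
    -- A list entry `(c, i, j, k)` stands for `c S^i N^j x^k`. In the expansions below, powers `x ^
    -- 3` and `x ^ 4` are already reduced to `x` and `x ^ 2`.
    rw [hX.jointMoment_succ hpqr (n + 1) 1 0 [(1, 1, 0, 0), (1, 0, 0, 1)]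
      (fun S N x _ => by simp)]
    simp only [List.map_cons, List.map_nil, List.sum_cons, List.sum_nil,
      integral_stepMonomial_zero, hX.integral_stepMonomial_one hpqr (Nat.le_add_left 1 n), ih,
      gammaGrowth_succ, zero_add]
    push_cast
    ring

lemma IsERWS.jointMoment_zero_one (hX : IsERWS μ p q r s X) (hpqr : p + q + r = 1) (n : ℕ) :
    jointMoment μ X 0 1 (n + 1) = gammaGrowth (p + q) n := by
  induction n with
  | zero => simp [hX.jointMoment_one_of_even Even.zero, gammaGrowth_zero]
  | succ n ih =>
    rw [hX.jointMoment_succ hpqr (n + 1) 0 1 [(1, 0, 1, 0), (1, 0, 0, 2)]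
      (fun S N x _ => by simp)]
    simp only [List.map_cons, List.map_nil, List.sum_cons, List.sum_nil,
      integral_stepMonomial_zero, hX.integral_stepMonomial_two hpqr (Nat.le_add_left 1 n), ih,
      gammaGrowth_succ, zero_add]
    push_cast
    ring

lemma IsERWS.jointMoment_zero_two (hX : IsERWS μ p q r s X) (hpqr : p + q + r = 1)
    (n : ℕ) :
    jointMoment μ X 0 2 (n + 1) = 2 * gammaGrowth (2 * (p + q)) n - gammaGrowth (p + q) n := by
  induction n with
  | zero => simp [hX.jointMoment_one_of_even Even.zero, gammaGrowth_zero]; norm_num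
  | succ n ih =>
    rw [hX.jointMoment_succ hpqr (n + 1) 0 2 [(1, 0, 2, 0), (2, 0, 1, 2), (1, 0, 0, 2)]
      (fun S N x hx => by rcases hx with rfl | rfl | rfl <;> simp <;> ring)]
    simp only [List.map_cons, List.map_nil, List.sum_cons, List.sum_nil,
      integral_stepMonomial_zero, hX.integral_stepMonomial_two hpqr (Nat.le_add_left 1 n), ih,
      gammaGrowth_succ, zero_add, Nat.reduceAdd, hX.jointMoment_zero_one hpqr]
    push_cast
    ring

lemma IsERWS.jointMoment_one_one (hX : IsERWS μ p q r s X) (hpqr : p + q + r = 1)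
    (hc : p + q ≠ 0) (n : ℕ) :
    jointMoment μ X 1 1 (n + 1) = (2 * s - 1) * ((1 + (p - q) / (p + q)) *
      gammaGrowth (2 * p) n - (p - q) / (p + q) * gammaGrowth (p - q) n) := by
  induction n with
  | zero => simp [hX.jointMoment_one_of_odd odd_one, gammaGrowth_zero]
  | succ n ih =>
    rw [hX.jointMoment_succ hpqr (n + 1) 1 1 [(1, 1, 1, 0), (1, 0, 1, 1), (1, 1, 0, 2), (1, 0, 0, 1)]
      (fun S N x hx => by rcases hx with rfl | rfl | rfl <;> simp <;> ring)]
    simp only [List.map_cons, List.map_nil, List.sum_cons, List.sum_nil,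
      integral_stepMonomial_zero, hX.integral_stepMonomial_two hpqr (Nat.le_add_left 1 n),
      hX.integral_stepMonomial_one hpqr (Nat.le_add_left 1 n), ih,
      gammaGrowth_succ, zero_add, hX.jointMoment_one_zero hpqr]
    push_cast
    field_simp
    ring

/-- The rate is `2(p - q)` and the source is `(p + q) E[N]`, of rate `p + q`; the denominator is the
difference of the two rates. -/
lemma IsERWS.jointMoment_two_zero (hX : IsERWS μ p q r s X) (hpqr : p + q + r = 1)
    (hd : p - q * 3 ≠ 0) (n : ℕ) :
    jointMoment μ X 2 0 (n + 1) = (2 * (p - q) * gammaGrowth (2 * (p - q)) n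
      - (p + q) * gammaGrowth (p + q) n) / (p - q * 3) := by
  induction n with
  | zero =>
    rw [hX.jointMoment_one_of_even even_two, gammaGrowth_zero, gammaGrowth_zero]
    field_simp
    ring
  | succ n ih =>
    rw [hX.jointMoment_succ hpqr (n + 1) 2 0 [(1, 2, 0, 0), (2, 1, 0, 1), (1, 0, 0, 2)]
      (fun S N x hx => by rcases hx with rfl | rfl | rfl <;> simp <;> ring)]
    simp only [List.map_cons, List.map_nil, List.sum_cons, List.sum_nil,
      integral_stepMonomial_zero, hX.integral_stepMonomial_two hpqr (Nat.le_add_left 1 n),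
      hX.integral_stepMonomial_one hpqr (Nat.le_add_left 1 n), ih,
      gammaGrowth_succ, zero_add, Nat.reduceAdd, hX.jointMoment_zero_one hpqr]
    push_cast
    field_simp
    ring

lemma IsERWS.jointMoment_three_zero (hX : IsERWS μ p q r s X) (hpqr : p + q + r = 1)
    (hc : p + q ≠ 0) (hd : p - q * 3 ≠ 0) (n : ℕ) :
    jointMoment μ X 3 0 (n + 1) = (2 * s - 1) * (6 * p / (p - q * 3) *
      (gammaGrowth (3 * (p - q)) n - gammaGrowth (2 * p) n) + gammaGrowth (p - q) n) := by
  induction n with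
  | zero => simp [hX.jointMoment_one_of_odd (i := 3) (by decide), gammaGrowth_zero]
  | succ n ih =>
    rw [hX.jointMoment_succ hpqr (n + 1) 3 0 [(1, 3, 0, 0), (3, 2, 0, 1), (3, 1, 0, 2), (1, 0, 0, 1)]
      (fun S N x hx => by rcases hx with rfl | rfl | rfl <;> simp <;> ring)]
    simp only [List.map_cons, List.map_nil, List.sum_cons, List.sum_nil,
      integral_stepMonomial_zero, hX.integral_stepMonomial_two hpqr (Nat.le_add_left 1 n),
      hX.integral_stepMonomial_one hpqr (Nat.le_add_left 1 n), ih,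
      gammaGrowth_succ, zero_add, Nat.reduceAdd, hX.jointMoment_one_zero hpqr,
      hX.jointMoment_one_one hpqr hc]
    push_cast
    field_simp
    ring

/-- Needed as a source for the fourth moment. The rate `3p - q` is `2(p - q) + (p + q)`. Its
difference `2(p - q)` from the rate `p + q` cancels against the source, so `p ≠ q` is not required.
-/
lemma IsERWS.jointMoment_two_one (hX : IsERWS μ p q r s X) (hpqr : p + q + r = 1)
    (hc : p + q ≠ 0) (hd : p - q * 3 ≠ 0) (n : ℕ) :
    jointMoment μ X 2 1 (n + 1) = (2 * (p - q) * (3 * p - q) / (p + q) *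
        gammaGrowth (3 * p - q) n
      - 4 * (p - q) ^ 2 / (p + q) * gammaGrowth (2 * (p - q)) n
      + (p + q) * gammaGrowth (p + q) n
      - 2 * (p + q) * gammaGrowth (2 * (p + q)) n) / (p - q * 3) := by
  induction n with
  | zero =>
    rw [hX.jointMoment_one_of_even even_two]
    simp only [gammaGrowth_zero]
    field_simp
    ring
  | succ n ih =>
    rw [hX.jointMoment_succ hpqr (n + 1) 2 1 [(1, 2, 1, 0), (2, 1, 1, 1), (1, 0, 1, 2),
        (1, 2, 0, 2), (2, 1, 0, 1), (1, 0, 0, 2)]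
      (fun S N x hx => by rcases hx with rfl | rfl | rfl <;> simp <;> ring)]
    simp only [List.map_cons, List.map_nil, List.sum_cons, List.sum_nil,
      integral_stepMonomial_zero, hX.integral_stepMonomial_two hpqr (Nat.le_add_left 1 n),
      hX.integral_stepMonomial_one hpqr (Nat.le_add_left 1 n), ih,
      gammaGrowth_succ, zero_add, Nat.reduceAdd, hX.jointMoment_zero_one hpqr,
      hX.jointMoment_zero_two hpqr, hX.jointMoment_two_zero hpqr hd]
    push_cast
    field_simp
    ring

/-- The new denominator `3p - 5q` is the gap between the rates `4(p - q)` and `p + q`. -/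
lemma IsERWS.jointMoment_four_zero (hX : IsERWS μ p q r s X) (hpqr : p + q + r = 1)
    (hc : p + q ≠ 0) (hd : p - q * 3 ≠ 0) (he : p * 3 - q * 5 ≠ 0) (n : ℕ) :
    jointMoment μ X 4 0 (n + 1) =
      24 * (p - q) * (3 * p ^ 2 - 6 * p * q - q ^ 2) /
        ((p * 3 - q * 5) * (p - q * 3) ^ 2) * gammaGrowth (4 * (p - q)) n
      - 12 * (p - q) * (3 * p - q) / (p - q * 3) ^ 2 * gammaGrowth (3 * p - q) n
      + 8 * (p - q) / (p - q * 3) * gammaGrowth (2 * (p - q)) n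
      + 6 * (p + q) ^ 2 / (p - q * 3) ^ 2 * gammaGrowth (2 * (p + q)) n
      - (p + q) * (3 * p + 7 * q) / ((p * 3 - q * 5) * (p - q * 3)) * gammaGrowth (p + q) n := by
  induction n with
  | zero =>
    rw [hX.jointMoment_one_of_even (i := 4) (by decide)]
    simp only [gammaGrowth_zero]
    field_simp
    ring
  | succ n ih =>
    rw [hX.jointMoment_succ hpqr (n + 1) 4 0 [(1, 4, 0, 0), (4, 3, 0, 1), (6, 2, 0, 2),
        (4, 1, 0, 1), (1, 0, 0, 2)]
      (fun S N x hx => by rcases hx with rfl | rfl | rfl <;> simp <;> ring)]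
    simp only [List.map_cons, List.map_nil, List.sum_cons, List.sum_nil,
      integral_stepMonomial_zero, hX.integral_stepMonomial_two hpqr (Nat.le_add_left 1 n),
      hX.integral_stepMonomial_one hpqr (Nat.le_add_left 1 n), ih,
      gammaGrowth_succ, zero_add, Nat.reduceAdd, hX.jointMoment_zero_one hpqr,
      hX.jointMoment_two_one hpqr hc hd, hX.jointMoment_two_zero hpqr hd]
    push_cast
    field_simp
    ring

end

/-! ### The martingale, moment asymptotics and the limit -/

section
variable {Ω : Type*} [m0 : MeasurableSpace Ω] {μ : Measure Ω} [IsProbabilityMeasure μ]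
  {p q r s : ℝ} {X : ℕ → Ω → ℝ}

/-- The filtration of the walk, with the time shifted by one. -/
def IsERWS.filtration (hX : IsERWS μ p q r s X) : Filtration ℕ m0 where
  seq n := stepHistory X (n + 1)
  mono' _ _ h := biSup_mono fun _ hk =>
    Finset.Icc_subset_Icc le_rfl (Nat.add_le_add_right h 1) hk
  le' n := hX.stepHistory_le (n + 1)

lemma IsERWS.integrable_position (hX : IsERWS μ p q r s X) (hpqr : p + q + r = 1) (n : ℕ) :
    Integrable (position X n) μ :=
  (hX.integrable_stepMonomial hpqr n 1 0 0).congr (.of_forall fun ω => by simp [stepMonomial])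

/-- The conditional mean of the position grows by the factor `1 + (p - q)/(n + 1)` from time `n +
1`, which is exactly the next factor of the product. -/
lemma IsERWS.martingale (hX : IsERWS μ p q r s X) (hpqr : p + q + r = 1) (hα : 0 < p - q) :
    Martingale (fun n ω => position X (n + 1) ω / gammaGrowth (p - q) n) hX.filtration μ := by
  refine martingale_nat (fun n => ?_) (fun n => (hX.integrable_position hpqr _).div_const _)
    fun n => ?_
  · exact (((measurable_position X (n + 1)).div_const _).stronglyMeasurable)
  · have hXint : Integrable (X (n + 1 + 1)) μ :=
      (hX.integrable_stepMonomial hpqr (n + 1) 0 0 1).congr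
        (.of_forall fun ω => by simp [stepMonomial])
    have hpos := hX.integrable_position hpqr (n + 1)
    have h1 : (fun ω => position X (n + 1 + 1) ω / gammaGrowth (p - q) (n + 1))
        = (gammaGrowth (p - q) (n + 1))⁻¹ • (position X (n + 1) + X (n + 1 + 1)) := by
      ext ω
      simp only [position_succ X (n + 1), Pi.smul_apply, Pi.add_apply, smul_eq_mul]
      ring
    have h2 : μ[position X (n + 1) | stepHistory X (n + 1)] = position X (n + 1) :=
      condExp_of_stronglyMeasurable (hX.stepHistory_le _)
        (measurable_position X (n + 1)).stronglyMeasurable hpos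
    rw [h1]
    filter_upwards [condExp_smul (μ := μ) (gammaGrowth (p - q) (n + 1))⁻¹
        (position X (n + 1) + X (n + 1 + 1)) (hX.filtration n),
      condExp_add (μ := μ) hpos hXint (hX.filtration n),
      (hX.condExp_step hpqr (Nat.le_add_left 1 n)).1] with ω e1 e2 e3
    have e2' : (μ[position X (n + 1) + X (n + 1 + 1) | hX.filtration n]) ω
        = position X (n + 1) ω + (p - q) / ((n + 1 : ℕ) : ℝ) * position X (n + 1) ω := by
      rw [e2, Pi.add_apply, ← e3]
      congr 1
      exact congrFun h2 ω
    rw [e1, Pi.smul_apply, e2', smul_eq_mul, gammaGrowth_succ]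
    have h3 := gammaGrowth_pos hα n
    push_cast
    field_simp

lemma IsERWS.memLp_position (hX : IsERWS μ p q r s X) (hpqr : p + q + r = 1) (n : ℕ)
    (e : ENNReal) : MemLp (position X n) e μ :=
  MemLp.of_bound (hX.integrable_position hpqr n).1 (n : ℝ)
    ((hX.ae_abs_le hpqr).mono fun _ h => (h n).1)

lemma IsERWS.tendsto_jointMoment_one (hX : IsERWS μ p q r s X) (hpqr : p + q + r = 1)
    (hα : 0 < p - q) :
    Tendsto (fun n : ℕ => jointMoment μ X 1 0 (n + 1) / ((n + 1 : ℕ) : ℝ) ^ (p - q)) atTop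
      (𝓝 ((2 * s - 1) / ((p - q) * Real.Gamma (p - q)))) := by
  have h := (tendsto_gammaGrowth_div_rpow hα).const_mul (2 * s - 1)
  rw [mul_one_div] at h
  refine h.congr fun n => ?_
  rw [hX.jointMoment_one_zero hpqr]
  ring

lemma IsERWS.tendsto_jointMoment_two (hX : IsERWS μ p q r s X) (hpqr : p + q + r = 1)
    (hc : 0 < p + q) (hα : 0 < p - q) (hd : 0 < p - q * 3) :
    Tendsto (fun n : ℕ => jointMoment μ X 2 0 (n + 1) / ((n + 1 : ℕ) : ℝ) ^ (2 * (p - q))) atTop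
      (𝓝 (1 / ((p - q * 3) * Real.Gamma (2 * (p - q))))) := by
  have h := (((tendsto_gammaGrowth_div_rpow (x := 2 * (p - q)) (by linarith)).const_mul
    (2 * (p - q))).sub ((tendsto_gammaGrowth_div_rpow_zero (x := p + q) (y := 2 * (p - q))
      hc (by linarith)).const_mul (p + q))).div_const (p - q * 3)
  have hG := Real.Gamma_pos_of_pos (s := 2 * (p - q)) (by linarith)
  convert h.congr fun n => ?_ using 2
  · field_simp
    ring
  · rw [hX.jointMoment_two_zero hpqr hd.ne']
    ring

lemma IsERWS.tendsto_jointMoment_three (hX : IsERWS μ p q r s X) (hpqr : p + q + r = 1)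
    (hc : 0 < p + q) (hα : 0 < p - q) (hd : 0 < p - q * 3) :
    Tendsto (fun n : ℕ => jointMoment μ X 3 0 (n + 1) / ((n + 1 : ℕ) : ℝ) ^ (3 * (p - q))) atTop
      (𝓝 (2 * p * (2 * s - 1) / ((p - q) * (p - q * 3) * Real.Gamma (3 * (p - q))))) := by
  have h := (((((tendsto_gammaGrowth_div_rpow (x := 3 * (p - q)) (by linarith)).sub
    (tendsto_gammaGrowth_div_rpow_zero (x := 2 * p) (y := 3 * (p - q))
      (by linarith) (by linarith))).const_mul (6 * p / (p - q * 3))).add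
    (tendsto_gammaGrowth_div_rpow_zero (x := p - q) (y := 3 * (p - q))
      hα (by linarith)))).const_mul (2 * s - 1)
  have hG := Real.Gamma_pos_of_pos (s := 3 * (p - q)) (by linarith)
  convert h.congr fun n => ?_ using 2
  · field_simp
    ring
  · rw [hX.jointMoment_three_zero hpqr hc.ne' hd.ne']
    ring

/-- Since `p > 3q`, all other rates, including the closest one `3p - q`, lie below `4(p - q)`. The
factor `4(p - q)` in Euler's limit turns `24(p - q)` into `6`. -/
lemma IsERWS.tendsto_jointMoment_four (hX : IsERWS μ p q r s X) (hpqr : p + q + r = 1)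
    (hc : 0 < p + q) (hα : 0 < p - q) (hd : 0 < p - q * 3) (he : 0 < p * 3 - q * 5) :
    Tendsto (fun n : ℕ => jointMoment μ X 4 0 (n + 1) / ((n + 1 : ℕ) : ℝ) ^ (4 * (p - q))) atTop
      (𝓝 (6 * (3 * p ^ 2 - 6 * p * q - q ^ 2) /
        ((p * 3 - q * 5) * (p - q * 3) ^ 2 * Real.Gamma (4 * (p - q))))) := by
  have h0 : ∀ {x : ℝ}, 0 < x → x < 4 * (p - q) → ∀ C : ℝ,
      Tendsto (fun n : ℕ => C * (gammaGrowth x n / ((n + 1 : ℕ) : ℝ) ^ (4 * (p - q)))) atTop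
        (𝓝 0) := fun hx hxy C => by
    simpa using (tendsto_gammaGrowth_div_rpow_zero hx hxy).const_mul C
  have h := (((((tendsto_gammaGrowth_div_rpow (x := 4 * (p - q)) (by linarith)).const_mul
      (24 * (p - q) * (3 * p ^ 2 - 6 * p * q - q ^ 2) / ((p * 3 - q * 5) * (p - q * 3) ^ 2))).sub
    (h0 (x := 3 * p - q) (by linarith) (by linarith)
      (12 * (p - q) * (3 * p - q) / (p - q * 3) ^ 2))).add
    (h0 (x := 2 * (p - q)) (by linarith) (by linarith) (8 * (p - q) / (p - q * 3)))).add
    (h0 (x := 2 * (p + q)) (by linarith) (by linarith) (6 * (p + q) ^ 2 / (p - q * 3) ^ 2))).sub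
    (h0 (x := p + q) hc (by linarith)
      ((p + q) * (3 * p + 7 * q) / ((p * 3 - q * 5) * (p - q * 3))))
  have hG := Real.Gamma_pos_of_pos (s := 4 * (p - q)) (by linarith)
  convert h.congr fun n => ?_ using 2
  · field_simp
    ring
  · rw [hX.jointMoment_four_zero hpqr hc.ne' hd.ne' he.ne']
    ring

/-- The normalized walk has an almost sure limit in `L⁴`, and its moments up to the fourth are
the limits of the moments of the normalized walk. -/
theorem IsERWS.exists_limit (hX : IsERWS μ p q r s X) (hpqr : p + q + r = 1)
    (hc : 0 < p + q) (hα : 0 < p - q) (hd : 0 < p - q * 3) (he : 0 < p * 3 - q * 5) :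
    ∃ L : Ω → ℝ, Measurable L ∧ MemLp L 4 μ ∧
      (∀ᵐ ω ∂μ, Tendsto (fun n : ℕ => position X n ω / (n : ℝ) ^ (p - q)) atTop (𝓝 (L ω))) ∧
      ∀ k ≤ 4, Tendsto (fun n : ℕ => jointMoment μ X k 0 (n + 1) / ((n + 1 : ℕ) : ℝ) ^ (k * (p - q)))
        atTop (𝓝 (∫ ω, L ω ^ k ∂μ)) := by
  -- Limit of the ratio between the martingale normalization and `n ^ (p - q)`; the sought limit is
  -- `κ` times the martingale limit.
  set κ : ℝ := 1 / ((p - q) * Real.Gamma (p - q)) with hκ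
  have hκ0 : κ ≠ 0 := by
    have := Real.Gamma_pos_of_pos hα
    positivity
  have hgrowth := tendsto_gammaGrowth_div_rpow hα
  rw [← hκ] at hgrowth
  have hratio : ∀ (k n : ℕ), jointMoment μ X k 0 (n + 1) / ((n + 1 : ℕ) : ℝ) ^ (k * (p - q))
      = (∫ ω, (position X (n + 1) ω / gammaGrowth (p - q) n) ^ k ∂μ)
        * (gammaGrowth (p - q) n / ((n + 1 : ℕ) : ℝ) ^ (p - q)) ^ k := fun k n => by
    have h1 := gammaGrowth_pos hα n
    have h2 : (0 : ℝ) < ((n + 1 : ℕ) : ℝ) ^ (p - q) := by positivity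
    have h3 : ((n + 1 : ℕ) : ℝ) ^ (k * (p - q)) = (((n + 1 : ℕ) : ℝ) ^ (p - q)) ^ k := by
      rw [mul_comm, Real.rpow_mul (by positivity), Real.rpow_natCast]
    simp only [div_pow, integral_div, jointMoment, pow_zero, mul_one, h3]
    field_simp
  have h4 : Tendsto (fun n : ℕ => ∫ ω, (position X (n + 1) ω / gammaGrowth (p - q) n) ^ 4 ∂μ)
      atTop (𝓝 (6 * (3 * p ^ 2 - 6 * p * q - q ^ 2) /
        ((p * 3 - q * 5) * (p - q * 3) ^ 2 * Real.Gamma (4 * (p - q))) / κ ^ 4)) := by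
    refine ((hX.tendsto_jointMoment_four hpqr hc hα hd he).div (hgrowth.pow 4)
      (pow_ne_zero 4 hκ0)).congr fun n => ?_
    have h1 := gammaGrowth_pos hα n
    have h2 : (0 : ℝ) < ((n + 1 : ℕ) : ℝ) ^ (p - q) := by positivity
    rw [Pi.div_apply, div_eq_iff (by positivity)]
    exact_mod_cast hratio 4 n
  obtain ⟨L, hLm, hL4, hlim, hmom⟩ :=
    (hX.martingale hpqr hα).exists_limit_of_tendsto_integral_pow_four
      (fun n => by
        simpa only [div_eq_inv_mul] using
          (hX.memLp_position hpqr (n + 1) 4).const_mul (gammaGrowth (p - q) n)⁻¹) h4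
  refine ⟨fun ω => L ω * κ, hLm.mul_const κ, by simpa only [mul_comm] using hL4.const_mul κ,
    ?_, fun k hk => ?_⟩
  · filter_upwards [hlim] with ω h
    rw [← tendsto_add_atTop_iff_nat 1]
    refine (h.mul hgrowth).congr fun n => ?_
    have h1 := gammaGrowth_pos hα n
    field_simp
  · simp only [mul_pow, integral_mul_const, hratio]
    exact (hmom k hk).mul (hgrowth.pow k)

end

theorem theorem3p8 {Ω : Type*} [MeasurableSpace Ω] (μ : Measure Ω) [IsProbabilityMeasure μ]
    (p q r s : ℝ) (hp : 0 ≤ p) (hq : 0 ≤ q) (hr : 0 ≤ r) (hr1 : r < 1) (hpqr : p + q + r = 1)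
    (hs : 0 ≤ s) (hs1 : s ≤ 1) (hsuper : 3 / 4 < p / (1 - r))
    (X : ℕ → Ω → ℝ) (hX : IsERWS μ p q r s X) :
    (∃ L : Ω → ℝ, Measurable L ∧ IsSuperdiffusiveLimit μ p r X L) ∧
    ∀ L : Ω → ℝ, IsSuperdiffusiveLimit μ p r X L →
      MemLp L 4 μ ∧
      ∫ ω, L ω ∂μ = (2 * s - 1) / ((2 * p + r - 1) * Real.Gamma (2 * p + r - 1)) ∧
      ∫ ω, L ω ^ 2 ∂μ =
        1 / ((4 * p + 3 * (r - 1)) * Real.Gamma (2 * (2 * p + r - 1))) ∧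
      ∫ ω, L ω ^ 3 ∂μ =
        2 * p * (2 * s - 1) /
          ((2 * p + r - 1) * (4 * p + 3 * (r - 1)) * Real.Gamma (3 * (2 * p + r - 1))) ∧
      ∫ ω, L ω ^ 4 ∂μ =
        6 * (8 * p ^ 2 - 4 * p * (1 - r) - (1 - r) ^ 2) /
          ((8 * p + 5 * (r - 1)) * (4 * p + 3 * (r - 1)) ^ 2 *
            Real.Gamma (4 * (2 * p + r - 1))) := by
  have hr' : r = 1 - p - q := by linarith
  have hc : 0 < p + q := by linarith
  -- With `1 - r = p + q` the regime becomes `p > 3q`, from which the positivity of the three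
  -- denominators follows using `q ≥ 0`.
  rw [lt_div_iff₀ (by linarith)] at hsuper
  have hd : 0 < p - q * 3 := by linarith
  have hα : 0 < p - q := by linarith
  have he : 0 < p * 3 - q * 5 := by linarith
  have e1 : 2 * p + r - 1 = p - q := by linarith
  have e2 : 4 * p + 3 * (r - 1) = p - q * 3 := by linarith
  have e3 : 8 * p + 5 * (r - 1) = p * 3 - q * 5 := by linarith
  have e4 : 8 * p ^ 2 - 4 * p * (1 - r) - (1 - r) ^ 2 = 3 * p ^ 2 - 6 * p * q - q ^ 2 := by
    rw [hr']; ring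
  obtain ⟨L₀, hL₀m, hL₀4, hlim, hmom⟩ := hX.exists_limit hpqr hc hα hd he
  simp only [IsSuperdiffusiveLimit, e1, e2, e3, e4]
  refine ⟨⟨L₀, hL₀m, hlim⟩, fun L hL => ?_⟩
  have hLL : L =ᵐ[μ] L₀ := by
    filter_upwards [hL, hlim] with ω h1 h2 using tendsto_nhds_unique h1 h2
  have hpow : ∀ k : ℕ, ∫ ω, L ω ^ k ∂μ = ∫ ω, L₀ ω ^ k ∂μ := fun k =>
    integral_congr_ae (hLL.fun_comp (· ^ k))
  have hone : ∫ ω, L ω ∂μ = ∫ ω, L₀ ω ^ 1 ∂μ := by simpa using hpow 1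
  refine ⟨(memLp_congr_ae hLL).2 hL₀4, ?_, ?_, ?_, ?_⟩
  · rw [hone]
    exact tendsto_nhds_unique (hmom 1 (by norm_num))
      (by simpa using hX.tendsto_jointMoment_one hpqr hα)
  · rw [hpow]
    exact tendsto_nhds_unique (hmom 2 (by norm_num))
      (by exact_mod_cast hX.tendsto_jointMoment_two hpqr hc hα hd)
  · rw [hpow]
    exact tendsto_nhds_unique (hmom 3 (by norm_num))
      (by exact_mod_cast hX.tendsto_jointMoment_three hpqr hc hα hd)
  · rw [hpow]
    exact tendsto_nhds_unique (hmom 4 (by norm_num))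
      (by exact_mod_cast hX.tendsto_jointMoment_four hpqr hc hα hd he)
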